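/- Let $n\in\mathbb N$. For $t=(t_{i,j,k})_{1\le i<j<k\le n}\in\mathbb Z^{\binom n3}$ let \[ G(t)=\langle a_1,\dots,a_n \mid a_ja_i=a_ia_j\,a_{j+1}^{t_{i,j,j+1}}\cdots a_n^{t_{i,j,n}}\ \text{ for } 1\le i<j\le n\rangle . \] Call $G(t)$ \emph{consistent} if it has Hirsch length precisely $n$ (the Hirsch length is the number of infinite factors in a finite subnormal series with cyclic factors), and let $\mathcal C_n$ be the set of all $t\in\mathbb Z^{\binom n3}$ for which $G(t)$ is consistent. Let $T=(T_{i,j,k})_{1\le i<j<k\le n}$, $x=(x_1,\dots,x_n)$, $y=(y_1,\dots,y_n)$ and $w=(w_1,\dots,w_n)$ be indeterminates. A tuple $F=(F_1,\dots,F_n)$ of polynomials $F_i(T;x,y)\in\mathbb Q[T][x,y]$ is called a tuple of \emph{multiplication polynomials} if for all $t\in\mathcal C_n$ and all $x,y\in\mathbb Z^n$ the values $F_1(t;x,y),\dots,F_n(t;x,y)$ are integers and \[ (a_1^{x_1}\cdots a_n^{x_n})(a_1^{y_1}\cdots a_n^{y_n})=a_1^{F_1(t;x,y)}\cdots a_n^{F_n(t;x,y)}\quad\text{in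 } G(t). \] \textbf{Theorem.} A tuple of multiplication polynomials exists. Moreover, let $F$ be any tuple of multiplication polynomials, let \[ P(T;x,y,w)=F(T;F(T;x,y),w)-F(T;x,F(T;y,w))=(P_1,\dots,P_n), \] and let $C_1(T),\dots,C_r(T)\in\mathbb Q[T]$ be the coefficients of $P_1,\dots,P_n$, considered as polynomials in $x,y,w$. If $t\in\mathcal C_n$, then $C_1(t)=\dots=C_r(t)=0$. -/

import Mathlib

/-- `G` has Hirsch length `h`: there is a finite subnormal series from `G` down to the trivial
subgroup with cyclic factors, exactly `h` of which are infinite. -/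
def HasHirschLength (G : Type*) [Group G] (h : ℕ) : Prop :=
  ∃ (m : ℕ) (H : ℕ → Subgroup G), H 0 = ⊤ ∧ H m = ⊥ ∧
    (∀ i < m, H (i + 1) ≤ H i ∧
      ∃ _ : ((H (i + 1)).subgroupOf (H i)).Normal,
        IsCyclic (↥(H i) ⧸ (H (i + 1)).subgroupOf (H i))) ∧
    {i : ℕ | i < m ∧ Infinite (↥(H i) ⧸ (H (i + 1)).subgroupOf (H i))}.ncard = h

namespace NilpotentPresentation

/-- The index set of the parameters `t i j k`, `i < j < k`. The generators `a 1, …, a n` are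
indexed by `Fin n`. -/
abbrev Triple (n : ℕ) : Type :=
  {p : Fin n × Fin n × Fin n // p.1 < p.2.1 ∧ p.2.1 < p.2.2}

/-- The relator `(a j * a i) * (a i * a j * a (j+1) ^ t i j (j+1) * ⋯ * a n ^ t i j n)⁻¹`
in the free group; the product is taken in increasing order of the index. -/
def relator {n : ℕ} (t : Triple n → ℤ) (i j : Fin n) (hij : i < j) : FreeGroup (Fin n) :=
  (FreeGroup.of j * FreeGroup.of i) *
    (FreeGroup.of i * FreeGroup.of j *
      ((List.finRange n).map fun k =>
        if hjk : j < k then FreeGroup.of k ^ t ⟨(i, j, k), hij, hjk⟩ else 1).prod)⁻¹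

/-- The group `G(t)`, generated by `a 1, …, a n` subject to the relations
`a j * a i = a i * a j * a (j+1) ^ t i j (j+1) * ⋯ * a n ^ t i j n` for `i < j`. -/
abbrev Grp {n : ℕ} (t : Triple n → ℤ) : Type :=
  PresentedGroup {r : FreeGroup (Fin n) | ∃ (i j : Fin n) (hij : i < j), r = relator t i j hij}

/-- The generator `a i` of `G(t)`. -/
def gen {n : ℕ} (t : Triple n → ℤ) (i : Fin n) : Grp t :=
  PresentedGroup.of i

/-- The ordered product `a 1 ^ x 1 * ⋯ * a n ^ x n` in `G(t)`. -/
def normalForm {n : ℕ} (t : Triple n → ℤ) (x : Fin n → ℤ) : Grp t :=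
  ((List.finRange n).map fun i => gen t i ^ x i).prod

/-- The set of all `t` for which the presentation `G(t)` is consistent, that is, for which `G(t)`
has Hirsch length precisely `n`. -/
def consistentParams (n : ℕ) : Set (Triple n → ℤ) :=
  {t | HasHirschLength (Grp t) n}

/-- The ring `ℚ[T]` of polynomials in the indeterminates `T i j k`, `i < j < k`. -/
abbrev ParamRing (n : ℕ) : Type :=
  MvPolynomial (Triple n) ℚ

/-- The value of a polynomial in `ℚ[T]` at the integral parameter vector `t`. -/
noncomputable def evalParam {n : ℕ} (t : Triple n → ℤ) : ParamRing n →+* ℚ :=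
  MvPolynomial.eval fun p => (t p : ℚ)

/-- The value `f(t; x, y)` of a polynomial `f ∈ ℚ[T][x, y]` at integral arguments. The left copy of
`Fin n` indexes the indeterminates `x`, the right copy the indeterminates `y`. -/
noncomputable def evalAt {n : ℕ} (f : MvPolynomial (Fin n ⊕ Fin n) (ParamRing n))
    (t : Triple n → ℤ) (x y : Fin n → ℤ) : ℚ :=
  MvPolynomial.eval₂ (evalParam t) (Sum.elim (fun i => (x i : ℚ)) (fun i => (y i : ℚ))) f

/-- `F = (F 1, …, F n)`, with `F i ∈ ℚ[T][x, y]`, are multiplication polynomials: for all `t` for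
which `G(t)` is consistent and all integral vectors `x`, `y`, the values `F i (t; x, y)` are
integers and `a ^ x * a ^ y = a ^ F(t; x, y)` holds in `G(t)`. -/
def IsMultiplicationPolynomials {n : ℕ}
    (F : Fin n → MvPolynomial (Fin n ⊕ Fin n) (ParamRing n)) : Prop :=
  ∀ t ∈ consistentParams n, ∀ x y : Fin n → ℤ, ∃ z : Fin n → ℤ,
    (∀ i, (z i : ℚ) = evalAt (F i) t x y) ∧
      normalForm t x * normalForm t y = normalForm t z

/-- The ring `ℚ[T][x, y, w]`. -/
abbrev DefectRing (n : ℕ) : Type :=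
  MvPolynomial (Fin n ⊕ Fin n ⊕ Fin n) (ParamRing n)

/-- The tuple `F(T; u, v)` for tuples `u`, `v` of polynomials in `ℚ[T][x, y, w]`. -/
noncomputable def subst {n : ℕ} (F : Fin n → MvPolynomial (Fin n ⊕ Fin n) (ParamRing n))
    (u v : Fin n → DefectRing n) (i : Fin n) : DefectRing n :=
  MvPolynomial.bind₁ (Sum.elim u v) (F i)

/-- The tuple of indeterminates `x`. -/
noncomputable def varX (n : ℕ) (i : Fin n) : DefectRing n := MvPolynomial.X (Sum.inl i)

/-- The tuple of indeterminates `y`. -/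
noncomputable def varY (n : ℕ) (i : Fin n) : DefectRing n := MvPolynomial.X (Sum.inr (Sum.inl i))

/-- The tuple of indeterminates `w`. -/
noncomputable def varW (n : ℕ) (i : Fin n) : DefectRing n := MvPolynomial.X (Sum.inr (Sum.inr i))

/-- The associativity defect `P(T; x, y, w) = F(T; F(T; x, y), w) - F(T; x, F(T; y, w))`. -/
noncomputable def defect {n : ℕ} (F : Fin n → MvPolynomial (Fin n ⊕ Fin n) (ParamRing n))
    (i : Fin n) : DefectRing n :=
  subst F (subst F (varX n) (varY n)) (varW n) i -
    subst F (varX n) (subst F (varY n) (varW n)) i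

/-- The set of all coefficients, in `ℚ[T]`, of `P 1, …, P n` as polynomials in `x, y, w`. -/
def defectCoeffs {n : ℕ} (F : Fin n → MvPolynomial (Fin n ⊕ Fin n) (ParamRing n)) :
    Set (ParamRing n) :=
  {C | ∃ (i : Fin n) (m : (Fin n ⊕ Fin n ⊕ Fin n) →₀ ℕ), C = MvPolynomial.coeff m (defect F i)}

end NilpotentPresentation

/-! Existence. Fix an algebra of parameter functions and consider families of elements whose
exponents lie in it. By downward induction on the position `i`, families of ordered products in `a
i, a (i+1), …` are closed under products and under discrete integration `h (m+1) = h m * g m`, `h 0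
= 1` (`polyClosed`). Collecting only needs conjugates of later generators by powers of `a i`, and
these are discrete integrals (`PolyClosed.conj_gen`). The functions given by polynomials in `T, x,
y` then yield `F`. Uniqueness of exponents plays no role here.

Vanishing. Hirsch length `n` forces all `n` factors of the tail series to be infinite
(`infiniteFactor_of_hasHirschLength`), so normal forms are unique. Associativity in the group then
makes the defect vanish at all integer points, hence as a polynomial. -/

namespace NilpotentPresentation

/-! ### Polynomial functions of an integer and their discrete integrals -/

/-- The functions on `X × ℤ` that are polynomial in the integer with coefficients in `𝒜`. -/
def polyExt {X : Type} (𝒜 : Subalgebra ℚ (X → ℚ)) : Subalgebra ℚ (X × ℤ → ℚ) :=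
  Algebra.adjoin ℚ ({F | ∃ c ∈ 𝒜, F = fun p => c p.1} ∪ {fun p => (p.2 : ℚ)})

/-- The integer valued function `u` belongs to the algebra `𝒜` of rational valued functions. -/
def IntMem {X : Type} (𝒜 : Subalgebra ℚ (X → ℚ)) (u : X → ℤ) : Prop :=
  (fun x => (u x : ℚ)) ∈ 𝒜

section

variable {X : Type} {𝒜 : Subalgebra ℚ (X → ℚ)}

lemma comp_fst_mem_polyExt {c : X → ℚ} (hc : c ∈ 𝒜) : (fun p : X × ℤ => c p.1) ∈ polyExt 𝒜 :=
  Algebra.subset_adjoin (Or.inl ⟨c, hc, rfl⟩)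

lemma snd_mem_polyExt : (fun p : X × ℤ => (p.2 : ℚ)) ∈ polyExt 𝒜 :=
  Algebra.subset_adjoin (Or.inr rfl)

lemma eval_snd_mem_polyExt (q : Polynomial ℚ) :
    (fun p : X × ℤ => q.eval (p.2 : ℚ)) ∈ polyExt 𝒜 := by
  have h : (fun p : X × ℤ => q.eval (p.2 : ℚ)) =
      Polynomial.aeval (fun p : X × ℤ => (p.2 : ℚ)) q := by
    ext p
    rw [Polynomial.aeval_fn_apply, Polynomial.coe_aeval_eq_eval]
  rw [h]
  exact Polynomial.aeval_mem_adjoin_singleton ℚ _ |> Algebra.adjoin_mono (by simp) 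

lemma polyExt_le_span : Subalgebra.toSubmodule (polyExt 𝒜) ≤ Submodule.span ℚ
    {F | ∃ c ∈ 𝒜, ∃ d : ℕ, F = fun p : X × ℤ => c p.1 * (p.2 : ℚ) ^ d} := by
  rw [polyExt, Algebra.adjoin_eq_span]
  refine Submodule.span_mono fun G hG => ?_
  induction hG using Submonoid.closure_induction with
  | mem G hG =>
    rcases hG with ⟨c, hc, rfl⟩ | rfl
    · exact ⟨c, hc, 0, by simp⟩
    · exact ⟨1, 𝒜.one_mem, 1, by simp⟩
  | one => exact ⟨1, 𝒜.one_mem, 0, by ext; simp⟩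
  | mul G H _ _ hG hH =>
    obtain ⟨c, hc, d, rfl⟩ := hG
    obtain ⟨c', hc', d', rfl⟩ := hH
    exact ⟨c * c', 𝒜.mul_mem hc hc', d + d', by ext; simp; ring⟩

/-- By linearity it suffices to sum `c(x) * m ^ d`, where the Bernoulli polynomials satisfy
`B_{d+1}(m+1) - B_{d+1}(m) = (d+1) * m ^ d`. -/
lemma exists_discrete_antiderivative {F : X × ℤ → ℚ} (hF : F ∈ polyExt 𝒜) :
    ∃ G ∈ polyExt 𝒜, (∀ x, G (x, 0) = 0) ∧ ∀ x m, G (x, m + 1) = G (x, m) + F (x, m) := by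
  have hF' := polyExt_le_span ((Subalgebra.mem_toSubmodule _).2 hF)
  clear hF
  induction hF' using Submodule.span_induction with
  | mem F h =>
    obtain ⟨c, hc, d, rfl⟩ := h
    set B := Polynomial.bernoulli (d + 1)
    have hd : ((d : ℚ) + 1) ≠ 0 := by positivity
    refine ⟨(fun p => c p.1) * (fun p => (Polynomial.C ((d + 1 : ℚ)⁻¹) *
      (B - Polynomial.C (B.eval 0))).eval (p.2 : ℚ)),
      mul_mem (comp_fst_mem_polyExt hc) (eval_snd_mem_polyExt _), by simp, fun x m => ?_⟩
    have hB : B.eval ((m : ℚ) + 1) = B.eval (m : ℚ) + (d + 1) * (m : ℚ) ^ d := by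
      rw [add_comm (m : ℚ), Polynomial.bernoulli_eval_one_add]
      simp [B]
    simp only [Pi.mul_apply, Polynomial.eval_mul, Polynomial.eval_C, Polynomial.eval_sub,
      Int.cast_add, Int.cast_one, hB]
    field_simp
    ring
  | zero => exact ⟨0, zero_mem _, by simp, by simp⟩
  | add F₁ F₂ h₁ h₂ ih₁ ih₂ =>
    obtain ⟨G₁, m₁, z₁, s₁⟩ := ih₁
    obtain ⟨G₂, m₂, z₂, s₂⟩ := ih₂
    refine ⟨G₁ + G₂, add_mem m₁ m₂, by simp [z₁, z₂], fun x m => ?_⟩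
    simp only [Pi.add_apply, s₁, s₂]
    ring
  | smul r F h ih =>
    obtain ⟨G, hG, z, s⟩ := ih
    refine ⟨r • G, Subalgebra.smul_mem _ hG r, by simp [z], fun x m => ?_⟩
    simp only [Pi.smul_apply, s, smul_add]

lemma comp_graph_mem {F : X × ℤ → ℚ} (hF : F ∈ polyExt 𝒜) {v : X → ℤ} (hv : IntMem 𝒜 v) :
    (fun x => F (x, v x)) ∈ 𝒜 := by
  induction hF using Algebra.adjoin_induction with
  | mem F h =>
    rcases h with ⟨c, hc, rfl⟩ | rfl
    · exact hc
    · exact hv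
  | algebraMap r => exact 𝒜.algebraMap_mem r
  | add F G _ _ hF hG => exact 𝒜.add_mem hF hG
  | mul F G _ _ hF hG => exact 𝒜.mul_mem hF hG

namespace IntMem

lemma const (r : ℤ) : IntMem 𝒜 fun _ => r := 𝒜.algebraMap_mem (r : ℚ)

lemma add {u v : X → ℤ} (hu : IntMem 𝒜 u) (hv : IntMem 𝒜 v) : IntMem 𝒜 fun x => u x + v x := by
  simp only [IntMem, Int.cast_add]
  exact 𝒜.add_mem hu hv

lemma neg {u : X → ℤ} (hu : IntMem 𝒜 u) : IntMem 𝒜 fun x => -u x := by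
  simp only [IntMem, Int.cast_neg]
  exact 𝒜.neg_mem hu

lemma comp_fst {u : X → ℤ} (hu : IntMem 𝒜 u) : IntMem (polyExt 𝒜) fun p => u p.1 :=
  comp_fst_mem_polyExt hu

lemma comp_graph {u : X × ℤ → ℤ} (hu : IntMem (polyExt 𝒜) u) {v : X → ℤ} (hv : IntMem 𝒜 v) :
    IntMem 𝒜 fun x => u (x, v x) :=
  comp_graph_mem hu hv

/-- The antiderivative has rational coefficients, but it starts at `0` and has integer increments,
so induction in both directions makes it integer valued. -/
lemma exists_sum {u : X × ℤ → ℤ} (hu : IntMem (polyExt 𝒜) u) :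
    ∃ U : X × ℤ → ℤ, IntMem (polyExt 𝒜) U ∧ (∀ x, U (x, 0) = 0) ∧
      ∀ x m, U (x, m + 1) = U (x, m) + u (x, m) := by
  obtain ⟨G, hG, z, s⟩ := exists_discrete_antiderivative hu
  have int : ∀ p : X × ℤ, ∃ k : ℤ, (k : ℚ) = G p := by
    rintro ⟨x, m⟩
    induction m using Int.induction_on with
    | zero => exact ⟨0, by simp [z]⟩
    | succ m ih =>
      obtain ⟨k, hk⟩ := ih
      exact ⟨k + u (x, m), by rw [s, ← hk]; push_cast; rfl⟩
    | pred m ih =>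
      obtain ⟨k, hk⟩ := ih
      have := s x (-m - 1)
      rw [sub_add_cancel] at this
      exact ⟨k - u (x, -m - 1), by rw [Int.cast_sub, hk, this]; ring⟩
  choose U hU using int
  refine ⟨U, ?_, fun x => ?_, fun x m => ?_⟩
  · simpa only [IntMem, hU] using hG
  · exact_mod_cast (hU (x, 0)).trans (z x)
  · have := s x m
    rw [← hU, ← hU] at this
    exact_mod_cast this

end IntMem

end

/-! ### Ordered products with exponents in an algebra of functions -/

variable {n : ℕ}

/-- The ordered product of the powers `a k ^ u k` over the `k` from position `i` onwards. -/
def tailProd (t : Triple n → ℤ) (i : ℕ) (u : Fin n → ℤ) : Grp t :=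
  (((List.finRange n).drop i).map fun k => gen t k ^ u k).prod

lemma le_of_mem_drop_finRange {i : ℕ} {k : Fin n} (h : k ∈ (List.finRange n).drop i) :
    i ≤ k := by
  obtain ⟨m, hm, rfl⟩ := List.mem_iff_getElem.1 h
  simp

lemma tailProd_of_le (t : Triple n → ℤ) {i : ℕ} (hi : n ≤ i) (u : Fin n → ℤ) :
    tailProd t i u = 1 := by
  simp [tailProd, List.drop_eq_nil_of_le, hi]

lemma tailProd_eq_mul (t : Triple n → ℤ) (i : Fin n) (u : Fin n → ℤ) :
    tailProd t i u = gen t i ^ u i * tailProd t (i + 1) u := by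
  rw [tailProd, List.drop_eq_getElem_cons (by simp)]
  simp [tailProd]

lemma tailProd_congr (t : Triple n → ℤ) {i : ℕ} {u v : Fin n → ℤ}
    (h : ∀ k : Fin n, i ≤ k → u k = v k) : tailProd t i u = tailProd t i v := by
  refine congrArg List.prod (List.map_congr_left fun k hk => ?_)
  rw [h k (le_of_mem_drop_finRange hk)]

lemma gen_mul_gen (t : Triple n → ℤ) {i j : Fin n} (hij : i < j) :
    gen t j * gen t i = gen t i * gen t j * ((List.finRange n).map fun k =>
      if hjk : j < k then gen t k ^ t ⟨(i, j, k), hij, hjk⟩ else 1).prod := by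
  have h := PresentedGroup.one_of_mem (rels :=
    {r : FreeGroup (Fin n) | ∃ (i j : Fin n) (hij : i < j), r = relator t i j hij})
    ⟨i, j, hij, rfl⟩
  rw [relator, map_mul, map_inv, mul_inv_eq_one, map_mul, map_mul, map_mul, map_list_prod,
    List.map_map] at h
  refine h.trans ?_
  congr 3
  ext k
  simp only [Function.comp_apply]
  split_ifs
  · rw [map_zpow]; rfl
  · rw [map_one]

/-- The family `g` of elements of the groups `G(τ x)` is an ordered product of powers of the
generators from position `i` onwards, with exponents in `𝒜`. -/
def PolyFamily {X : Type} (𝒜 : Subalgebra ℚ (X → ℚ)) (τ : X → Triple n → ℤ) (i : ℕ)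
    (g : ∀ x, Grp (τ x)) : Prop :=
  ∃ u : X → Fin n → ℤ, (∀ k, IntMem 𝒜 fun x => u x k) ∧ ∀ x, g x = tailProd (τ x) i (u x)

/-- Polynomial families of elements from position `i` onwards are closed under products and under
discrete integration, over every algebra of functions that contains the parameters. -/
def PolyClosed (n i : ℕ) : Prop :=
  ∀ (X : Type) (𝒜 : Subalgebra ℚ (X → ℚ)) (τ : X → Triple n → ℤ),
    (∀ p, IntMem 𝒜 fun x => τ x p) →
    (∀ g h : ∀ x, Grp (τ x), PolyFamily 𝒜 τ i g → PolyFamily 𝒜 τ i h →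
      PolyFamily 𝒜 τ i fun x => g x * h x) ∧
    ∀ g h : ∀ x, ℤ → Grp (τ x),
      PolyFamily (polyExt 𝒜) (fun p => τ p.1) i (fun p => g p.1 p.2) →
      (∀ x, h x 0 = 1) → (∀ x m, h x (m + 1) = h x m * g x m) →
      PolyFamily (polyExt 𝒜) (fun p => τ p.1) i (fun p => h p.1 p.2)

section

variable {X : Type} {𝒜 : Subalgebra ℚ (X → ℚ)} {τ : X → Triple n → ℤ} {i : ℕ}

namespace PolyFamily

lemma one : PolyFamily 𝒜 τ i fun _ => 1 :=
  ⟨fun _ _ => 0, fun _ => .const 0, fun x => by simp [tailProd]⟩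

lemma zpow_mul {i : Fin n} {v : X → ℤ} (hv : IntMem 𝒜 v) {g : ∀ x, Grp (τ x)}
    (hg : PolyFamily 𝒜 τ (i + 1) g) :
    PolyFamily 𝒜 τ i fun x => gen (τ x) i ^ v x * g x := by
  obtain ⟨u, hu, hgu⟩ := hg
  refine ⟨fun x => Function.update (u x) i (v x), fun k => ?_, fun x => ?_⟩
  · by_cases hk : k = i
    · subst hk
      simpa using hv
    · simpa [hk] using hu k
  · dsimp only
    rw [tailProd_eq_mul, Function.update_self, hgu]
    congr 1
    refine tailProd_congr _ fun k hk => ?_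
    rw [Function.update_of_ne]
    rintro rfl
    omega

lemma exists_eq_zpow_mul {i : Fin n} {g : ∀ x, Grp (τ x)} (hg : PolyFamily 𝒜 τ i g) :
    ∃ (v : X → ℤ) (g' : ∀ x, Grp (τ x)), IntMem 𝒜 v ∧ PolyFamily 𝒜 τ (i + 1) g' ∧
      ∀ x, g x = gen (τ x) i ^ v x * g' x := by
  obtain ⟨u, hu, hgu⟩ := hg
  exact ⟨fun x => u x i, _, hu i, ⟨u, hu, fun x => rfl⟩, fun x => by rw [hgu, tailProd_eq_mul]⟩

lemma of_succ (hi : i < n) {g : ∀ x, Grp (τ x)} (hg : PolyFamily 𝒜 τ (i + 1) g) :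
    PolyFamily 𝒜 τ i g := by
  simpa using zpow_mul (i := ⟨i, hi⟩) (.const 0) hg

lemma gen_zpow (j : Fin n) {v : X → ℤ} (hv : IntMem 𝒜 v) (hij : i ≤ j) :
    PolyFamily 𝒜 τ i fun x => gen (τ x) j ^ v x := by
  induction hij using Nat.decreasingInduction with
  | of_succ k hk ih => exact ih.of_succ (hk.trans j.2)
  | self => simpa using zpow_mul hv one

lemma comp_fst {g : ∀ x, Grp (τ x)} (hg : PolyFamily 𝒜 τ i g) :
    PolyFamily (polyExt 𝒜) (fun p => τ p.1) i fun p => g p.1 := by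
  obtain ⟨u, hu, hgu⟩ := hg
  exact ⟨fun p => u p.1, fun k => (hu k).comp_fst, fun p => hgu p.1⟩

lemma comp_graph {g : ∀ x, ℤ → Grp (τ x)}
    (hg : PolyFamily (polyExt 𝒜) (fun p => τ p.1) i fun p => g p.1 p.2)
    {v : X → ℤ} (hv : IntMem 𝒜 v) : PolyFamily 𝒜 τ i fun x => g x (v x) := by
  obtain ⟨u, hu, hgu⟩ := hg
  exact ⟨fun x => u (x, v x), fun k => (hu k).comp_graph hv, fun x => hgu (x, v x)⟩

end PolyFamily

namespace PolyClosed

variable (hc : PolyClosed n i) (hτ : ∀ p, IntMem 𝒜 fun x => τ x p)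

include hc hτ

lemma mul {g h : ∀ x, Grp (τ x)} (hg : PolyFamily 𝒜 τ i g) (hh : PolyFamily 𝒜 τ i h) :
    PolyFamily 𝒜 τ i fun x => g x * h x :=
  (hc X 𝒜 τ hτ).1 g h hg hh

lemma integral {g h : ∀ x, ℤ → Grp (τ x)}
    (hg : PolyFamily (polyExt 𝒜) (fun p => τ p.1) i fun p => g p.1 p.2)
    (h0 : ∀ x, h x 0 = 1) (hs : ∀ x m, h x (m + 1) = h x m * g x m) :
    PolyFamily (polyExt 𝒜) (fun p => τ p.1) i fun p => h p.1 p.2 :=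
  (hc X 𝒜 τ hτ).2 g h hg h0 hs

/-- `m ↦ g ^ m` is the discrete integral of a family constant in `m`; then `m = v x` is substituted.
-/
lemma zpow {g : ∀ x, Grp (τ x)} (hg : PolyFamily 𝒜 τ i g) {v : X → ℤ} (hv : IntMem 𝒜 v) :
    PolyFamily 𝒜 τ i fun x => g x ^ v x :=
  (hc.integral hτ (h := fun x m => g x ^ m) hg.comp_fst (fun _ => zpow_zero _)
    (fun _ _ => zpow_add_one _ _)).comp_graph hv

lemma list_prod {ι : Type} (l : List ι) (f : ι → ∀ x, Grp (τ x))
    (hf : ∀ k ∈ l, PolyFamily 𝒜 τ i (f k)) :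
    PolyFamily 𝒜 τ i fun x => (l.map fun k => f k x).prod := by
  induction l with
  | nil => exact .one
  | cons k l ih =>
    simp only [List.map_cons, List.prod_cons]
    exact hc.mul hτ (hf k (by simp)) (ih fun k' hk' => hf k' (by simp [hk']))

end PolyClosed

end

/-! ### Conjugation and the induction on the position -/

/-- Write `c k s` for the conjugate of `a k`. Conjugating the defining relation by `a i ^ s` gives
`c j (s+1) = c j s * ∏ c k s ^ t i j k` over `k > j`, so `(a j)⁻¹ * c j s` is the discrete integral
of a product already known to be polynomial by induction from larger `k`. -/
lemma PolyClosed.conj_gen {i : Fin n} (hc : PolyClosed n (i + 1)) {X : Type}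
    {𝒜 : Subalgebra ℚ (X → ℚ)} {τ : X → Triple n → ℤ} (hτ : ∀ p, IntMem 𝒜 fun x => τ x p)
    (j : Fin n) (hij : i < j) :
    PolyFamily (polyExt 𝒜) (fun p => τ p.1) (i + 1)
      fun p => gen (τ p.1) i ^ (-p.2) * gen (τ p.1) j * gen (τ p.1) i ^ p.2 := by
  induction j using WellFoundedGT.induction with
  | ind j ih =>
  have hτ' : ∀ q, IntMem (polyExt 𝒜) fun p : X × ℤ => τ p.1 q := fun q => (hτ q).comp_fst
  let c (k : Fin n) (x : X) (s : ℤ) : Grp (τ x) :=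
    gen (τ x) i ^ (-s) * gen (τ x) k * gen (τ x) i ^ s
  let f (k : Fin n) (x : X) (s : ℤ) : Grp (τ x) :=
    if hjk : j < k then c k x s ^ τ x ⟨(i, j, k), hij, hjk⟩ else 1
  have hd : PolyFamily (polyExt 𝒜) (fun p => τ p.1) (i + 1)
      fun p => ((List.finRange n).map fun k => f k p.1 p.2).prod := by
    refine hc.list_prod hτ' _ (fun k p => f k p.1 p.2) fun k _ => ?_
    by_cases hjk : j < k
    · simp only [f, hjk, dif_pos]
      exact hc.zpow hτ' (ih k hjk (hij.trans hjk)) (hτ' _)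
    · simp only [f, hjk, dif_neg, not_false_eq_true]
      exact .one
  have hI := hc.integral hτ (g := fun x s => ((List.finRange n).map fun k => f k x s).prod)
    (h := fun x s => (gen (τ x) j)⁻¹ * c j x s) hd (fun x => by simp [c]) fun x s => by
      have hf : ((List.finRange n).map fun k => f k x s).prod =
          gen (τ x) i ^ (-s) * ((List.finRange n).map fun k =>
            if hjk : j < k then gen (τ x) k ^ τ x ⟨(i, j, k), hij, hjk⟩ else 1).prod *
              gen (τ x) i ^ s := by
        have := map_list_prod (MulAut.conj (gen (τ x) i ^ (-s))) ((List.finRange n).map fun k =>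
            if hjk : j < k then gen (τ x) k ^ τ x ⟨(i, j, k), hij, hjk⟩ else 1)
        rw [MulAut.conj_apply, ← zpow_neg, neg_neg] at this
        rw [this, List.map_map]
        congr 2
        ext k
        simp only [Function.comp_apply, f, c]
        split_ifs
        · rw [map_zpow, MulAut.conj_apply, ← zpow_neg, neg_neg]
        · rw [map_one]
      have hr := gen_mul_gen (τ x) hij
      rw [hf]
      simp only [c]
      rw [show -(s + 1) = -s + -1 by ring, zpow_add, add_comm s 1, zpow_add, zpow_one, zpow_neg_one]
      have hr' : (gen (τ x) i)⁻¹ * (gen (τ x) j * gen (τ x) i) = _ :=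
        congrArg ((gen (τ x) i)⁻¹ * ·) hr
      simp only [mul_assoc] at hr' ⊢
      rw [← mul_assoc (gen (τ x) j) (gen (τ x) i), ← mul_assoc (gen (τ x) i)⁻¹]
      rw [hr']
      group
  have := hc.mul hτ' (PolyFamily.gen_zpow (τ := fun p : X × ℤ => τ p.1) j (.const 1) hij) hI
  simpa [c] using this

lemma PolyClosed.conj {i : Fin n} (hc : PolyClosed n (i + 1)) {X : Type}
    {𝒜 : Subalgebra ℚ (X → ℚ)} {τ : X → Triple n → ℤ} (hτ : ∀ p, IntMem 𝒜 fun x => τ x p)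
    {g : ∀ x, Grp (τ x)} (hg : PolyFamily 𝒜 τ (i + 1) g) {v : X → ℤ} (hv : IntMem 𝒜 v) :
    PolyFamily 𝒜 τ (i + 1) fun x => gen (τ x) i ^ (-v x) * g x * gen (τ x) i ^ v x := by
  obtain ⟨u, hu, hgu⟩ := hg
  have h := hc.list_prod hτ ((List.finRange n).drop (i + 1))
    (fun k x => (gen (τ x) i ^ (-v x) * gen (τ x) k * gen (τ x) i ^ v x) ^ u x k) fun k hk =>
      hc.zpow hτ (PolyFamily.comp_graph (g := fun x s => gen (τ x) i ^ (-s) * gen (τ x) k *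
        gen (τ x) i ^ s) (hc.conj_gen hτ k (le_of_mem_drop_finRange hk)) hv) (hu k)
  convert h using 2 with x
  have := map_list_prod (MulAut.conj (gen (τ x) i ^ (-v x)))
    (((List.finRange n).drop (i + 1)).map fun k => gen (τ x) k ^ u x k)
  rw [MulAut.conj_apply, ← zpow_neg, neg_neg] at this
  rw [hgu, tailProd, this, List.map_map]
  congr 2
  ext k
  simp only [Function.comp_apply]
  rw [map_zpow, MulAut.conj_apply, ← zpow_neg, neg_neg]

lemma polyClosed_of_le {i : ℕ} (hi : n ≤ i) : PolyClosed n i := by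
  refine fun X 𝒜 τ _ => ⟨?_, ?_⟩
  · rintro g h ⟨u, hu, hg⟩ ⟨v, hv, hh⟩
    refine ⟨u, hu, fun x => ?_⟩
    simp only [hg, hh, tailProd_of_le _ hi, mul_one]
  · rintro g h ⟨u, hu, hg⟩ h0 hs
    refine ⟨u, hu, fun ⟨x, m⟩ => ?_⟩
    have hs' : ∀ m, h x (m + 1) = h x m := fun m => by
      have := hg (x, m)
      dsimp only at this
      rw [hs, this, tailProd_of_le _ hi, mul_one]
    rw [tailProd_of_le _ hi]
    change h x m = 1
    induction m using Int.induction_on with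
    | zero => exact h0 x
    | succ m ih => rw [hs', ih]
    | pred m ih => rw [← hs', sub_add_cancel, ih]

lemma PolyClosed.of_succ (i : Fin n) (hc : PolyClosed n (i + 1)) : PolyClosed n i := by
  refine fun X 𝒜 τ hτ => ⟨fun g h hg hh => ?_, fun g h hg h0 hs => ?_⟩
  -- Collection: `a^u g' a^v h' = a^(u+v) (a^(-v) g' a^v) h'` with `a = a i`.
  · obtain ⟨u, g', hu, hg', hgu⟩ := hg.exists_eq_zpow_mul
    obtain ⟨v, h', hv, hh', hhv⟩ := hh.exists_eq_zpow_mul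
    convert PolyFamily.zpow_mul (hu.add hv) (hc.mul hτ (hc.conj hτ hg' hv) hh') using 2 with x
    rw [hgu, hhv]
    group
  · have hτ' : ∀ q, IntMem (polyExt 𝒜) fun p : X × ℤ => τ p.1 q := fun q => (hτ q).comp_fst
    obtain ⟨u, g', hu, hg', hgu⟩ := hg.exists_eq_zpow_mul
    obtain ⟨U, hU, U0, Us⟩ := hu.exists_sum
    -- With `U` the sum of `u`, the product `h * a i ^ (-U)` has increments in the next tail: `a i ^
    -- (U+u) * g' * a i ^ (-(U+u))`.
    have hI := hc.integral hτ
      (g := fun x s => gen (τ x) i ^ (-(-(U (x, s) + u (x, s)))) * g' (x, s) *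
        gen (τ x) i ^ (-(U (x, s) + u (x, s))))
      (h := fun x s => h x s * gen (τ x) i ^ (-U (x, s)))
      (hc.conj hτ' hg' (hU.add hu).neg) (fun x => by simp [h0, U0]) fun x s => by
        have := hgu (x, s)
        dsimp only at this
        rw [hs, Us, this]
        group
    convert PolyFamily.zpow_mul hU (hc.conj hτ' hI hU) using 2 with p
    group

theorem polyClosed (n i : ℕ) : PolyClosed n i := by
  rcases le_total n i with hi | hi
  · exact polyClosed_of_le hi
  · induction hi using Nat.decreasingInduction with
    | of_succ k hk ih => exact PolyClosed.of_succ ⟨k, hk⟩ ih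
    | self => exact polyClosed_of_le le_rfl

/-! ### Existence of multiplication polynomials -/

/-- The functions of `(t, x, y)` that are values of polynomials in `ℚ[T][x, y]`. -/
def evalAtAlgebra (n : ℕ) :
    Subalgebra ℚ ((Triple n → ℤ) × (Fin n → ℤ) × (Fin n → ℤ) → ℚ) where
  carrier := {φ | ∃ f, ∀ p, φ p = evalAt f p.1 p.2.1 p.2.2}
  mul_mem' := by
    rintro _ _ ⟨f, hf⟩ ⟨g, hg⟩
    exact ⟨f * g, fun p => by rw [Pi.mul_apply, hf, hg, evalAt, evalAt, evalAt,
      MvPolynomial.eval₂_mul]⟩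
  add_mem' := by
    rintro _ _ ⟨f, hf⟩ ⟨g, hg⟩
    exact ⟨f + g, fun p => by rw [Pi.add_apply, hf, hg, evalAt, evalAt, evalAt,
      MvPolynomial.eval₂_add]⟩
  algebraMap_mem' r :=
    ⟨MvPolynomial.C (MvPolynomial.C r), fun p => by simp [evalAt, evalParam]⟩

theorem exists_isMultiplicationPolynomials (n : ℕ) :
    ∃ F : Fin n → MvPolynomial (Fin n ⊕ Fin n) (ParamRing n), IsMultiplicationPolynomials F := by
  have hT : ∀ q, IntMem (evalAtAlgebra n) fun p => p.1 q := fun q =>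
    ⟨MvPolynomial.C (MvPolynomial.X q), fun p => by simp [evalAt, evalParam]⟩
  have hx : PolyFamily (evalAtAlgebra n) Prod.fst 0 fun p => normalForm p.1 p.2.1 :=
    ⟨fun p => p.2.1, fun k => ⟨MvPolynomial.X (Sum.inl k), fun p => by simp [evalAt]⟩,
      fun p => rfl⟩
  have hy : PolyFamily (evalAtAlgebra n) Prod.fst 0 fun p => normalForm p.1 p.2.2 :=
    ⟨fun p => p.2.2, fun k => ⟨MvPolynomial.X (Sum.inr k), fun p => by simp [evalAt]⟩,
      fun p => rfl⟩
  obtain ⟨u, hu, huv⟩ := (polyClosed n 0).mul hT hx hy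
  choose F hF using hu
  exact ⟨F, fun t _ x y => ⟨u (t, x, y), fun i => hF i (t, x, y), huv (t, x, y)⟩⟩

/-! ### The tail series and the Hirsch length -/

/-- The subgroup of the ordered products of powers of generators from position `i` onwards. -/
def tailSubgroup (t : Triple n → ℤ) (i : ℕ) : Subgroup (Grp t) where
  carrier := {g | PolyFamily (⊤ : Subalgebra ℚ (Unit → ℚ)) (fun _ => t) i fun _ => g}
  mul_mem' hg hh := (polyClosed n i).mul (𝒜 := (⊤ : Subalgebra ℚ (Unit → ℚ)))
    (τ := fun _ => t) (fun _ => trivial) hg hh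
  one_mem' := PolyFamily.one
  inv_mem' {g} hg := by
    simpa using! (polyClosed n i).zpow (𝒜 := (⊤ : Subalgebra ℚ (Unit → ℚ))) (τ := fun _ => t)
      (v := fun _ => -1) (fun _ => trivial) hg trivial

section

variable {t : Triple n → ℤ} {i : ℕ}

/-- Over a one-point space with the full algebra of functions, the condition on the exponents is
vacuous. -/
lemma mem_tailSubgroup {g : Grp t} : g ∈ tailSubgroup t i ↔ ∃ u, g = tailProd t i u :=
  ⟨fun ⟨u, _, h⟩ => ⟨u (), h ()⟩, fun ⟨u, h⟩ => ⟨fun _ => u, fun _ => trivial, fun _ => h⟩⟩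

lemma tailSubgroup_zero : tailSubgroup t 0 = ⊤ := by
  rw [eq_top_iff, ← PresentedGroup.closure_range_of, Subgroup.closure_le]
  rintro _ ⟨j, rfl⟩
  simpa using! PolyFamily.gen_zpow (𝒜 := (⊤ : Subalgebra ℚ (Unit → ℚ))) (τ := fun _ => t) j
    (v := fun _ => 1) trivial (Nat.zero_le _)

lemma tailSubgroup_self : tailSubgroup t n = ⊥ := by
  rw [eq_bot_iff]
  intro g hg
  obtain ⟨u, rfl⟩ := mem_tailSubgroup.1 hg
  exact tailProd_of_le t le_rfl u

lemma conj_mem_tailSubgroup {i : Fin n} {g : Grp t} (hg : g ∈ tailSubgroup t (i + 1)) (v : ℤ) :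
    gen t i ^ (-v) * g * gen t i ^ v ∈ tailSubgroup t (i + 1) :=
  (polyClosed n (i + 1)).conj (𝒜 := (⊤ : Subalgebra ℚ (Unit → ℚ))) (τ := fun _ => t)
    (fun _ => trivial) hg (v := fun _ => v) trivial

lemma mul_mem_coset {i : Fin n} {g h : Grp t} {r s : ℤ}
    (hg : gen t i ^ (-r) * g ∈ tailSubgroup t (i + 1))
    (hh : gen t i ^ (-s) * h ∈ tailSubgroup t (i + 1)) :
    gen t i ^ (-(r + s)) * (g * h) ∈ tailSubgroup t (i + 1) := by
  convert mul_mem (conj_mem_tailSubgroup hg s) hh using 1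
  group

lemma inv_mem_coset {i : Fin n} {g : Grp t} {r : ℤ}
    (hg : gen t i ^ (-r) * g ∈ tailSubgroup t (i + 1)) :
    gen t i ^ (- -r) * g⁻¹ ∈ tailSubgroup t (i + 1) := by
  convert conj_mem_tailSubgroup (inv_mem hg) (-r) using 1
  group

lemma zpow_mem_coset {i : Fin n} {g : Grp t} {r : ℤ}
    (hg : gen t i ^ (-r) * g ∈ tailSubgroup t (i + 1)) (m : ℤ) :
    gen t i ^ (-(m * r)) * g ^ m ∈ tailSubgroup t (i + 1) := by
  induction m using Int.induction_on with
  | zero => simp [one_mem]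
  | succ m ih => simpa only [add_mul, one_mul, zpow_add_one] using mul_mem_coset ih hg
  | pred m ih =>
    rw [sub_mul, one_mul, zpow_sub_one, sub_eq_add_neg]
    exact mul_mem_coset ih (inv_mem_coset hg)

lemma exists_coset {i : Fin n} {g : Grp t} (hg : g ∈ tailSubgroup t i) :
    ∃ r : ℤ, gen t i ^ (-r) * g ∈ tailSubgroup t (i + 1) := by
  obtain ⟨u, rfl⟩ := mem_tailSubgroup.1 hg
  exact ⟨u i, mem_tailSubgroup.2 ⟨u, by rw [tailProd_eq_mul]; group⟩⟩

end

/-- The factor of the series of tail subgroups at position `i` is infinite. -/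
def InfiniteFactor (t : Triple n → ℤ) (i : Fin n) : Prop :=
  ∀ m : ℤ, gen t i ^ m ∈ tailSubgroup t (i + 1) → m = 0

lemma exists_infinite_order_mod {G : Type*} [Group G] {H K : Subgroup G}
    [(K.subgroupOf H).Normal] [IsCyclic (H ⧸ K.subgroupOf H)] [Infinite (H ⧸ K.subgroupOf H)] :
    ∃ g ∈ H, ∀ m : ℤ, g ^ m ∈ K → m = 0 := by
  obtain ⟨q, hq⟩ := IsCyclic.exists_generator (α := H ⧸ K.subgroupOf H)
  obtain ⟨g, rfl⟩ := QuotientGroup.mk_surjective q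
  refine ⟨g, g.2, fun m hm => ?_⟩
  have h0 : orderOf (QuotientGroup.mk g : H ⧸ K.subgroupOf H) = 0 :=
    Infinite.orderOf_eq_zero_of_forall_mem_zpowers hq
  have h1 : (QuotientGroup.mk g : H ⧸ K.subgroupOf H) ^ m = 1 := by
    rw [← QuotientGroup.mk_zpow, QuotientGroup.eq_one_iff, Subgroup.mem_subgroupOf]
    exact hm
  have := orderOf_dvd_iff_zpow_eq_one.2 h1
  rw [h0] at this
  simpa using this

/-- If `h ∈ K`, then `g ^ s * h` has infinite order modulo `K` whenever `g` has. -/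
lemma infinite_order_mod_zpow_mul {G : Type*} [Group G] {H K : Subgroup G} (hKH : K ≤ H)
    [(K.subgroupOf H).Normal] {g h : G} (hg : g ∈ H) (hh : h ∈ K)
    (hgi : ∀ m : ℤ, g ^ m ∈ K → m = 0) {s : ℤ} (hs : s ≠ 0) (m : ℤ) (hm : (g ^ s * h) ^ m ∈ K) :
    m = 0 := by
  let g' : H := ⟨g, hg⟩
  let h' : H := ⟨h, hKH hh⟩
  have e1 : (QuotientGroup.mk h' : H ⧸ K.subgroupOf H) = 1 :=
    (QuotientGroup.eq_one_iff _).2 (Subgroup.mem_subgroupOf.2 hh)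
  have e2 : (QuotientGroup.mk ((g' ^ s * h') ^ m) : H ⧸ K.subgroupOf H) = 1 :=
    (QuotientGroup.eq_one_iff _).2 (Subgroup.mem_subgroupOf.2 (by simpa [g', h'] using hm))
  rw [QuotientGroup.mk_zpow, QuotientGroup.mk_mul, e1, mul_one, ← QuotientGroup.mk_zpow,
    ← zpow_mul, QuotientGroup.eq_one_iff, Subgroup.mem_subgroupOf] at e2
  exact (mul_eq_zero.1 (hgi _ (by simpa [g'] using e2))).resolve_left hs

/-- To each infinite factor `a` of the given series, attach the last position `d a` whose tail still
meets `H a` in an element of infinite order modulo `H (a+1)`. The tail factor at `d a` is infinite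
and `d` is injective; `n` infinite factors therefore exhaust all `n` positions. -/
lemma infiniteFactor_of_hasHirschLength {t : Triple n → ℤ} (ht : HasHirschLength (Grp t) n)
    (i : Fin n) : InfiniteFactor t i := by
  obtain ⟨m, H, -, -, hH, hcard⟩ := ht
  have hle : ∀ a b, a ≤ b → b ≤ m → H b ≤ H a := by
    intro a b hab
    induction b, hab using Nat.le_induction with
    | base => exact fun _ => le_rfl
    | succ b _ ih => exact fun hb => (hH b hb).1.trans (ih (Nat.le_of_succ_le hb))
  set S := {a : ℕ | a < m ∧ Infinite (↥(H a) ⧸ (H (a + 1)).subgroupOf (H a))}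
  let Q (a j : ℕ) : Prop := ∃ g ∈ H a, g ∈ tailSubgroup t j ∧ ∀ m : ℤ, g ^ m ∈ H (a + 1) → m = 0
  have hQ : ∀ a ∈ S, ∃ j : Fin n, Q a j ∧ ¬ Q a (j + 1) := by
    rintro a ⟨ha, hinf⟩
    by_contra! hcon
    obtain ⟨-, hN, hcyc⟩ := hH a ha
    have hall : ∀ j ≤ n, Q a j := by
      intro j hj
      induction j with
      | zero =>
        obtain ⟨g, hg, hgi⟩ := exists_infinite_order_mod (H := H a) (K := H (a + 1))
        exact ⟨g, hg, by simp [tailSubgroup_zero], hgi⟩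
      | succ j ih => exact hcon ⟨j, hj⟩ (ih (Nat.le_of_succ_le hj))
    obtain ⟨g, -, hg, hgi⟩ := hall n le_rfl
    rw [tailSubgroup_self, Subgroup.mem_bot] at hg
    simpa using hgi 1 (by simp [hg, one_mem])
  have : Nonempty (Fin n) := ⟨i⟩
  choose! d hd hd' using hQ
  have hinf : ∀ a ∈ S, InfiniteFactor t (d a) := by
    intro a ha s hs
    by_contra hs0
    obtain ⟨g, hg, hgt, hgi⟩ := hd a ha
    obtain ⟨r, hr⟩ := exists_coset hgt
    -- If `a (d a) ^ s` lay in the next tail with `s ≠ 0`, then so would `g ^ s`, contradicting the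
    -- choice of `d a`.
    refine hd' a ha ⟨g ^ s, zpow_mem hg s, ?_, fun k hk => ?_⟩
    · have := mul_mem (zpow_mem hs r) (zpow_mem_coset hr s)
      rwa [← zpow_mul, ← mul_assoc, ← zpow_add, add_neg_cancel, zpow_zero, one_mul] at this
    · rw [← zpow_mul] at hk
      exact (mul_eq_zero.1 (hgi _ hk)).resolve_left hs0
  have hlt : ∀ a ∈ S, ∀ b ∈ S, a < b → d a ≠ d b := by
    intro a ha b hb hab hdab
    obtain ⟨g, hg, hgt, hgi⟩ := hd a ha
    obtain ⟨h, hh, hht, hhi⟩ := hd b hb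
    rw [← hdab] at hht
    obtain ⟨r, hr⟩ := exists_coset hgt
    obtain ⟨s, hs⟩ := exists_coset hht
    by_cases hs0 : s = 0
    · refine hd' b hb ⟨h, hh, ?_, hhi⟩
      rw [← hdab]
      simpa [hs0] using hs
    -- In `g ^ s * h ^ (-r)` the leading exponents cancel, pushing it into the next tail; as `h ∈ H
    -- (a+1)`, it keeps infinite order modulo `H (a+1)`.
    · have hh' : h ∈ H (a + 1) := hle (a + 1) b hab hb.1.le hh
      obtain ⟨hsub, hN, -⟩ := hH a ha.1
      refine hd' a ha ⟨g ^ s * h ^ (-r), mul_mem (zpow_mem hg s) (zpow_mem (hsub hh') _), ?_,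
        fun k hk => infinite_order_mod_zpow_mul hsub hg (zpow_mem hh' _) hgi hs0 k hk⟩
      have := mul_mem_coset (zpow_mem_coset hr s) (zpow_mem_coset hs (-r))
      rwa [show -(s * r + -r * s) = 0 by ring, zpow_zero, one_mul] at this
  have hinj : Set.InjOn d S := by
    intro a ha b hb hab
    rcases lt_trichotomy a b with h | h | h
    · exact (hlt a ha b hb h hab).elim
    · exact h
    · exact (hlt b hb a ha h hab.symm).elim
  have himg : d '' S = Set.univ :=
    Set.eq_of_subset_of_ncard_le (Set.subset_univ _)
      (by rw [hinj.ncard_image, hcard, Set.ncard_univ, Nat.card_fin])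
  obtain ⟨a, ha, rfl⟩ := himg.ge (Set.mem_univ i)
  exact hinf a ha

/-! ### Unique normal forms and the associativity defect -/

lemma tailProd_injective {t : Triple n → ℤ} (ht : ∀ i, InfiniteFactor t i) {i : ℕ} (hi : i ≤ n)
    {u v : Fin n → ℤ} (h : tailProd t i u = tailProd t i v) (k : Fin n) (hk : i ≤ k) :
    u k = v k := by
  induction hi using Nat.decreasingInduction with
  | self => omega
  | of_succ i hi ih =>
    have hu := tailProd_eq_mul t ⟨i, hi⟩ u
    have hv := tailProd_eq_mul t ⟨i, hi⟩ v
    dsimp only at hu hv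
    rw [hu, hv] at h
    have huv : u ⟨i, hi⟩ = v ⟨i, hi⟩ := by
      have h1 : gen t ⟨i, hi⟩ ^ (u ⟨i, hi⟩ - v ⟨i, hi⟩) =
          tailProd t (i + 1) v * (tailProd t (i + 1) u)⁻¹ := by
        rw [eq_mul_inv_iff_mul_eq, sub_eq_neg_add, zpow_add, mul_assoc, h]
        group
      have h2 := ht ⟨i, hi⟩ (u ⟨i, hi⟩ - v ⟨i, hi⟩) (by
        rw [h1]
        exact mul_mem (mem_tailSubgroup.2 ⟨_, rfl⟩) (inv_mem (mem_tailSubgroup.2 ⟨_, rfl⟩)))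
      omega
    rcases hk.eq_or_lt with rfl | hlt
    · exact huv
    · rw [huv] at h
      exact ih (mul_left_cancel h) hlt

lemma normalForm_injective {t : Triple n → ℤ} (ht : t ∈ consistentParams n) :
    Function.Injective (normalForm t) := fun _ _ h =>
  funext fun k => tailProd_injective (infiniteFactor_of_hasHirschLength ht) (Nat.zero_le n) h k
    (Nat.zero_le _)

lemma eval₂_subst (F : Fin n → MvPolynomial (Fin n ⊕ Fin n) (ParamRing n)) (t : Triple n → ℤ)
    (u v : Fin n → DefectRing n) (a : Fin n ⊕ Fin n ⊕ Fin n → ℚ) (x y : Fin n → ℤ)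
    (hu : ∀ i, MvPolynomial.eval₂ (evalParam t) a (u i) = x i)
    (hv : ∀ i, MvPolynomial.eval₂ (evalParam t) a (v i) = y i) (i : Fin n) :
    MvPolynomial.eval₂ (evalParam t) a (subst F u v i) = evalAt (F i) t x y := by
  have h := MvPolynomial.eval₂Hom_bind₁ (evalParam t) a (Sum.elim u v) (F i)
  rw [MvPolynomial.coe_eval₂Hom, MvPolynomial.coe_eval₂Hom] at h
  rw [subst, h, evalAt]
  congr 1
  ext (k | k)
  · exact hu k
  · exact hv k

theorem eval₂_defect_eq_zero {F : Fin n → MvPolynomial (Fin n ⊕ Fin n) (ParamRing n)}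
    (hF : IsMultiplicationPolynomials F) {t : Triple n → ℤ} (ht : t ∈ consistentParams n)
    (a : Fin n ⊕ Fin n ⊕ Fin n → ℤ) (i : Fin n) :
    MvPolynomial.eval₂ (evalParam t) (fun k => (a k : ℚ)) (defect F i) = 0 := by
  let x (k : Fin n) := a (Sum.inl k)
  let y (k : Fin n) := a (Sum.inr (Sum.inl k))
  let w (k : Fin n) := a (Sum.inr (Sum.inr k))
  obtain ⟨xy, hxy, exy⟩ := hF t ht x y
  obtain ⟨yw, hyw, eyw⟩ := hF t ht y w
  obtain ⟨l, hl, el⟩ := hF t ht xy w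
  obtain ⟨r, hr, er⟩ := hF t ht x yw
  have hlr : l = r := normalForm_injective ht (by rw [← el, ← er, ← exy, ← eyw, mul_assoc])
  have hX : ∀ k, MvPolynomial.eval₂ (evalParam t) (fun k => (a k : ℚ)) (varX n k) = x k :=
    fun k => MvPolynomial.eval₂_X _ _ _
  have hY : ∀ k, MvPolynomial.eval₂ (evalParam t) (fun k => (a k : ℚ)) (varY n k) = y k :=
    fun k => MvPolynomial.eval₂_X _ _ _
  have hW : ∀ k, MvPolynomial.eval₂ (evalParam t) (fun k => (a k : ℚ)) (varW n k) = w k :=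
    fun k => MvPolynomial.eval₂_X _ _ _
  rw [defect, MvPolynomial.eval₂_sub,
    eval₂_subst F t _ _ _ xy w (fun k => by rw [eval₂_subst F t _ _ _ x y hX hY, hxy]) hW,
    eval₂_subst F t _ _ _ x yw hX (fun k => by rw [eval₂_subst F t _ _ _ y w hY hW, hyw]),
    ← hl, ← hr, hlr, sub_self]

theorem evalParam_eq_zero_of_mem_defectCoeffs
    {F : Fin n → MvPolynomial (Fin n ⊕ Fin n) (ParamRing n)}
    (hF : IsMultiplicationPolynomials F) {t : Triple n → ℤ} (ht : t ∈ consistentParams n)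
    {C : ParamRing n} (hC : C ∈ defectCoeffs F) : evalParam t C = 0 := by
  obtain ⟨i, m, rfl⟩ := hC
  have h0 : MvPolynomial.map (evalParam t) (defect F i) = 0 := by
    -- A rational polynomial vanishing at all integer points is zero, `ℤ` being infinite in `ℚ`.
    refine MvPolynomial.funext_set (fun _ => Set.range ((↑) : ℤ → ℚ))
      (fun _ => Set.infinite_range_of_injective Int.cast_injective) fun z hz => ?_
    choose a ha using fun k => hz k (Set.mem_univ k)
    obtain rfl : (fun k => (a k : ℚ)) = z := funext ha
    rw [MvPolynomial.eval_map, eval₂_defect_eq_zero hF ht, map_zero]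
  rw [← MvPolynomial.coeff_map, h0, MvPolynomial.coeff_zero]

end NilpotentPresentation

theorem mainTheorem1 (n : ℕ) :
    (∃ F : Fin n → MvPolynomial (Fin n ⊕ Fin n) (NilpotentPresentation.ParamRing n),
      NilpotentPresentation.IsMultiplicationPolynomials F) ∧
    ∀ F : Fin n → MvPolynomial (Fin n ⊕ Fin n) (NilpotentPresentation.ParamRing n),
      NilpotentPresentation.IsMultiplicationPolynomials F →
        ∀ t ∈ NilpotentPresentation.consistentParams n,
          ∀ C ∈ NilpotentPresentation.defectCoeffs F,
            NilpotentPresentation.evalParam t C = 0 :=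
  ⟨NilpotentPresentation.exists_isMultiplicationPolynomials n, fun _ hF _ ht _ hC =>
    NilpotentPresentation.evalParam_eq_zero_of_mem_defectCoeffs hF ht hC⟩
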